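/- Let $r\ge 1$ and $n\ge 2$ be integers and $N=2n+1$. Parameters are $\theta=(a,\tau)$ with $a\in\mathbb C^r$, $\tau\in\mathbb R^r$. Let $$F_N(t)=\frac1{n+1}\sum_{k=-n}^{n}\Bigl(1-\frac{|k|}{n+1}\Bigr)e^{2\pi i k t}$$ be the normalized Fejér kernel (so $F_N''(0)=-\tfrac23\pi^2n(n+2)<0$), let $g_k=\sqrt{\tfrac1{n+1}\bigl(1-\tfrac{|k|}{n+1}\bigr)}$, and let $\Phi(\theta)\in\mathbb C^N$ have entries $\Phi(\theta)_k=g_k\sum_{\ell=1}^r a_\ell e^{-2\pi i k\tau_\ell}$, $-n\le k\le n$. Fix a ground truth $\theta^\star=(a^\star,\tau^\star)$ with $a^\star_\ell\neq0$ for all $\ell$, and put $\mathcal L(\theta)=\tfrac12\|\Phi(\theta)-\Phi(\theta^\star)\|_2^2$. Let $\nabla\mathcal L(\theta)$ be its gradient, whose entry for the amplitude $a_j$ is $\partial\mathcal L/\partial(\operatorname{Re}a_j)+i\,\partial\mathcal L/\partial(\operatorname{Im}a_j)$ and whose entry for $\tau_j$ is $\partial\mathcal L/\partial\tau_j$. Put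 $a^\star_{\min}=\min_\ell|a^\star_\ell|$, $\|a^\star\|_\infty=\max_\ell|a^\star_\ell|$, and $$\Delta(\tau^\star)=\min_{\ell\ne\ell'}\inf_{p\in\mathbb Z}|\tau^\star_\ell-\tau^\star_{\ell'}+p|$$ (with $\Delta(\tau^\star)=+\infty$ if $r=1$), and let $S=\operatorname{diag}\bigl((a^\star)^{-1},\sqrt{-F_N''(0)}\,\mathbf 1_r\bigr)$, so that $$\|S(\theta-\theta^\star)\|_\infty=\max_j\max\Bigl\{\frac{|a_j-a_j^\star|}{|a_j^\star|},\ \sqrt{-F_N''(0)}\,|\tau_j-\tau_j^\star|\Bigr\}.$$ Assume that $\Delta(\tau^\star)>0$ and $$\gamma:=11.60\,\frac{\|a^\star\|_\infty}{a^\star_{\min}}\bigl((n+1)\Delta(\tau^\star)\bigr)^{-2}<\frac12$$ (with $\gamma=0$ if $r=1$). Let $\theta_0$ satisfy $\|S(\theta_0-\theta^\star)\|_\infty\le 1-\sqrt{2/3}$ and let $$\theta_{k+1}=\theta_k-P_k\nabla\mathcal L(\theta_k),\qquad P_k=\operatorname{diag}\bigl(\mathbf 1_r,\,-F_N''(0)^{-1}|a_k|^{-2}\bigr),\qquad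 \theta_k=(a_k,\tau_k),$$ where $|a_k|^{-2}$ is taken entrywise. Then $\theta_k\to\theta^\star$ and, for all $k\in\mathbb N$, $$\|S(\theta_k-\theta^\star)\|_\infty\le\Bigl(\frac12+\gamma\Bigr)^k\|S(\theta_0-\theta^\star)\|_\infty .$$ -/

import Mathlib

namespace SpikeDeconv

/-- Parameters `θ = (a, τ)` of `r` spikes: complex amplitudes and real locations.
The norm carried by this type is the entrywise sup norm `‖·‖∞`. -/
abbrev Params (r : ℕ) : Type := (Fin r → ℂ) × (Fin r → ℝ)

/-- The normalized Fejér kernel of order `2n+1` (the exponential sum is real-valued). -/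
noncomputable def fejer (n : ℕ) (t : ℝ) : ℝ :=
  ((1 / ((n : ℂ) + 1)) * ∑ k ∈ Finset.Icc (-(n : ℤ)) (n : ℤ),
    (1 - ((|k| : ℤ) : ℂ) / ((n : ℂ) + 1)) *
      Complex.exp (Complex.I * (2 * Real.pi * k * t : ℝ))).re

/-- `F_N''(0)`. -/
noncomputable def fejerCurv (n : ℕ) : ℝ := iteratedDeriv 2 (fejer n) 0

/-- The Fourier weights `g_k` of the point spread function, `-n ≤ k ≤ n`. -/
noncomputable def psfWeight (n : ℕ) (k : ℤ) : ℝ :=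
  √((1 / ((n : ℝ) + 1)) * (1 - ((|k| : ℤ) : ℝ) / ((n : ℝ) + 1)))

/-- The `k`-th entry of the observation `Φ(μ(θ))`: the weight `g_k` times the Fourier transform
at frequency `k` of the spike measure `μ(θ) = ∑ ℓ, a_ℓ δ_{τ_ℓ}`. -/
noncomputable def observe {r : ℕ} (n : ℕ) (θ : Params r) (k : ℤ) : ℂ :=
  (psfWeight n k : ℂ) *
    ∑ l : Fin r, θ.1 l * Complex.exp (-Complex.I * (2 * Real.pi * k * θ.2 l : ℝ))

/-- The least-squares loss `½ ‖Φ(μ(θ)) - Φ(μ(θ⋆))‖₂²`. -/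
noncomputable def loss {r : ℕ} (n : ℕ) (θs θ : Params r) : ℝ :=
  (1 / 2) * ∑ k ∈ Finset.Icc (-(n : ℤ)) (n : ℤ), ‖observe n θ k - observe n θs k‖ ^ 2

/-- The gradient of the loss, entry by entry. For an amplitude it is the gradient in `ℂ` regarded
as a real Euclidean plane, `∂L/∂(Re a_j) + i ∂L/∂(Im a_j)`; for a location it is the
partial derivative. -/
noncomputable def gradLoss {r : ℕ} (n : ℕ) (θs θ : Params r) : Params r :=
  (fun j => gradient (𝕜 := ℝ)
      (fun z : ℂ => loss n θs (Function.update θ.1 j z, θ.2)) (θ.1 j),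
   fun j => deriv (fun t : ℝ => loss n θs (θ.1, Function.update θ.2 j t)) (θ.2 j))

/-- The adaptive diagonal preconditioner `diag(1, -F_N''(0)⁻¹ |a|⁻²)` at `θ = (a, τ)`,
applied to the vector `v`. -/
noncomputable def precond {r : ℕ} (n : ℕ) (θ v : Params r) : Params r :=
  (v.1, fun j => -(fejerCurv n)⁻¹ * (‖θ.1 j‖ ^ 2)⁻¹ * v.2 j)

/-- The diagonal weighting `S = diag(a⋆⁻¹, √(-F_N''(0)))` applied to the vector `v`. -/
noncomputable def scale {r : ℕ} (n : ℕ) (θs v : Params r) : Params r :=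
  (fun j => (θs.1 j)⁻¹ * v.1 j, fun j => √(-fejerCurv n) * v.2 j)

/-- The minimal wrap-around distance. It is `⊤` when there is only one point. -/
noncomputable def wrapSep {r : ℕ} (τ : Fin r → ℝ) : ENNReal :=
  ⨅ (l : Fin r) (l' : Fin r) (_ : l ≠ l') (p : ℤ), ENNReal.ofReal |τ l - τ l' + p|

/-- The smallest amplitude modulus. -/
noncomputable def ampMin {r : ℕ} (a : Fin r → ℂ) : ℝ := ⨅ l, ‖a l‖

/-- `γ = 11.60 (‖a⋆‖∞ / a⋆_min) ((n+1) Δ(τ⋆))⁻²`, with value `⊤` if two locations coincide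
modulo `1` and value `0` for a single spike. -/
noncomputable def gammaConst {r : ℕ} (n : ℕ) (θs : Params r) : ENNReal :=
  ENNReal.ofReal (11.60 * (‖θs.1‖ / ampMin θs.1)) * ((((n : ENNReal) + 1) * wrapSep θs.2) ^ 2)⁻¹

end SpikeDeconv

/-! Write F for the kernel, s² = -F''(0) and ε for the weighted error `‖scale n θs (θ - θs)‖`. One
step multiplies ε by at most 1/2 + γ as long as ε ≤ 0.1836, and this region is preserved, so
induction gives the rate.

Correlating the atoms with the observations turns the gradient into kernel sums: the entry for a_j
is Σ_l (a_l F(τ_j - τ_l) - a⋆_l F(τ_j - τ⋆_l)), and the entry for τ_j is the real part of conj(a_j)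
times the same sum with F' (`gradLoss_amplitude`, `gradLoss_location`).

The terms l = j behave like a single-spike problem. As F(0) = 1, F'(0) = 0 and F'(δ) ≈ -s²δ, the
preconditioned step cancels the linear error up to the mismatch between a_j and a⋆_j. What remains
is of second order in ε, hence at most ε/2 (`amplitude_step_le`, `location_step_le`).

The terms l ≠ j are differences, so they are proportional to ε and not merely small. The mean value
theorem bounds each by tails of the kernel and its derivative, which decay like the inverse square
of the wrapped distance. Separation lets Basel's series sum these tails, and the dynamic range ‖a⋆‖∞
/ a⋆_min compares a⋆_l with a⋆_j; together they give at most γε (`norm_cross_sum_le`,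
`interaction_sum_le`). -/

namespace SpikeDeconv

open Finset ComplexConjugate

/-! ### Fourier series of the Fejér kernel and its derivatives -/

/-- The squared Fourier weights, that is, the Fourier coefficients of the Fejér kernel. -/
noncomputable def fejerCoeff (n : ℕ) (k : ℤ) : ℝ :=
  (1 / ((n : ℝ) + 1)) * (1 - ((|k| : ℤ) : ℝ) / ((n : ℝ) + 1))

/-- The first derivative of the Fejér kernel. -/
noncomputable def fejerDeriv (n : ℕ) (t : ℝ) : ℝ :=
  ∑ k ∈ Icc (-(n : ℤ)) (n : ℤ), fejerCoeff n k * (-Real.sin (2 * Real.pi * k * t) * (2 * Real.pi * k))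

/-- The second derivative of the Fejér kernel. -/
noncomputable def fejerDeriv2 (n : ℕ) (t : ℝ) : ℝ :=
  ∑ k ∈ Icc (-(n : ℤ)) (n : ℤ),
    fejerCoeff n k * (-Real.cos (2 * Real.pi * k * t) * (2 * Real.pi * k) ^ 2)

theorem fejerCoeff_nonneg {n : ℕ} {k : ℤ} (hk : k ∈ Icc (-(n : ℤ)) (n : ℤ)) :
    0 ≤ fejerCoeff n k := by
  have h : |k| ≤ (n : ℤ) := abs_le.2 (mem_Icc.1 hk)
  have h' : ((|k| : ℤ) : ℝ) ≤ (n : ℝ) := by exact_mod_cast h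
  have : ((|k| : ℤ) : ℝ) / ((n : ℝ) + 1) ≤ 1 := by
    rw [div_le_one (by positivity)]; linarith
  unfold fejerCoeff
  have : 0 ≤ 1 - ((|k| : ℤ) : ℝ) / ((n : ℝ) + 1) := by linarith
  positivity

theorem fejerCoeff_neg (n : ℕ) (k : ℤ) : fejerCoeff n (-k) = fejerCoeff n k := by
  simp [fejerCoeff]

theorem psfWeight_sq {n : ℕ} {k : ℤ} (hk : k ∈ Icc (-(n : ℤ)) (n : ℤ)) :
    psfWeight n k ^ 2 = fejerCoeff n k :=
  Real.sq_sqrt (fejerCoeff_nonneg hk)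

theorem fejerCoeff_eq (n : ℕ) (k : ℤ) :
    fejerCoeff n k = ((n : ℝ) + 1 - ((|k| : ℤ) : ℝ)) / ((n : ℝ) + 1) ^ 2 := by
  have : (n : ℝ) + 1 ≠ 0 := by positivity
  unfold fejerCoeff
  field_simp

theorem fejer_eq_sum (n : ℕ) (t : ℝ) :
    fejer n t = ∑ k ∈ Icc (-(n : ℤ)) (n : ℤ), fejerCoeff n k * Real.cos (2 * Real.pi * k * t) := by
  unfold fejer
  rw [Finset.mul_sum, Complex.re_sum]
  refine Finset.sum_congr rfl fun k _ => ?_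
  have h : (1 / ((n : ℂ) + 1)) * ((1 - ((|k| : ℤ) : ℂ) / ((n : ℂ) + 1)) *
      Complex.exp (Complex.I * (2 * Real.pi * k * t : ℝ))) =
      ((fejerCoeff n k : ℝ) : ℂ) * Complex.exp ((2 * Real.pi * k * t : ℝ) * Complex.I) := by
    simp only [fejerCoeff, Complex.ofReal_mul, Complex.ofReal_sub, Complex.ofReal_div,
      Complex.ofReal_one, Complex.ofReal_add, Complex.ofReal_natCast, Complex.ofReal_intCast]
    ring_nf
  rw [h, Complex.re_ofReal_mul, Complex.exp_ofReal_mul_I_re]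

theorem hasDerivAt_fejer (n : ℕ) (t : ℝ) : HasDerivAt (fejer n) (fejerDeriv n t) t := by
  have h : fejer n = fun t => ∑ k ∈ Icc (-(n : ℤ)) (n : ℤ),
      fejerCoeff n k * Real.cos (2 * Real.pi * k * t) := funext (fejer_eq_sum n)
  rw [h]
  refine HasDerivAt.fun_sum fun k _ => ?_
  exact (((hasDerivAt_id t).const_mul (2 * Real.pi * k)).cos.const_mul _).congr_deriv (by simp)

theorem hasDerivAt_fejerDeriv (n : ℕ) (t : ℝ) :
    HasDerivAt (fejerDeriv n) (fejerDeriv2 n t) t := by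
  refine HasDerivAt.fun_sum fun k _ => ?_
  exact ((((hasDerivAt_id t).const_mul (2 * Real.pi * k)).sin.neg.mul_const _).const_mul
    _).congr_deriv (by simp only [mul_one, id_eq]; ring)

theorem fejerCurv_eq_deriv2 (n : ℕ) : fejerCurv n = fejerDeriv2 n 0 := by
  unfold fejerCurv
  rw [iteratedDeriv_succ, iteratedDeriv_one,
    show deriv (fejer n) = fejerDeriv n from funext fun t => (hasDerivAt_fejer n t).deriv,
    (hasDerivAt_fejerDeriv n 0).deriv]

/-! ### Symmetric sums, closed forms and the curvature -/

theorem sum_Icc_neg_comp_neg {E : Type*} [AddCommMonoid E] (n : ℕ) (f : ℤ → E) :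
    ∑ k ∈ Icc (-(n : ℤ)) (n : ℤ), f (-k) = ∑ k ∈ Icc (-(n : ℤ)) (n : ℤ), f k :=
  Finset.sum_equiv (Equiv.neg ℤ) (fun k => by simp only [mem_Icc, Equiv.neg_apply]; omega)
    fun _ _ => rfl

theorem sum_Icc_neg_eq_zero_of_odd (n : ℕ) (f : ℤ → ℝ) (hf : ∀ k, f (-k) = -f k) :
    ∑ k ∈ Icc (-(n : ℤ)) (n : ℤ), f k = 0 := by
  have h := sum_Icc_neg_comp_neg n f
  simp only [hf, Finset.sum_neg_distrib] at h
  linarith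

theorem sum_Icc_neg_succ (n : ℕ) (f : ℤ → ℝ) :
    ∑ k ∈ Icc (-((n + 1 : ℕ) : ℤ)) ((n + 1 : ℕ) : ℤ), f k =
      ∑ k ∈ Icc (-(n : ℤ)) (n : ℤ), f k + f ((n : ℤ) + 1) + f (-((n : ℤ) + 1)) := by
  have h : Icc (-((n + 1 : ℕ) : ℤ)) ((n + 1 : ℕ) : ℤ) =
      insert (-((n : ℤ) + 1)) (insert ((n : ℤ) + 1) (Icc (-(n : ℤ)) (n : ℤ))) := by
    ext k; simp only [mem_Icc, mem_insert]; omega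
  rw [h, Finset.sum_insert, Finset.sum_insert]
  · ring
  · simp only [mem_Icc]; omega
  · simp only [mem_Icc, mem_insert]; omega

/-- Raising n adds one to every triangular weight, so triangular sums accumulate plain symmetric
sums. This is the induction step for the closed form of the kernel and for its moments. -/
theorem sum_Icc_neg_triangle_succ (n : ℕ) (f : ℤ → ℝ) :
    ∑ k ∈ Icc (-((n + 1 : ℕ) : ℤ)) ((n + 1 : ℕ) : ℤ), (((n + 1 : ℕ) : ℝ) + 1 - ((|k| : ℤ) : ℝ)) * f k =
      ∑ k ∈ Icc (-(n : ℤ)) (n : ℤ), ((n : ℝ) + 1 - ((|k| : ℤ) : ℝ)) * f k +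
        ∑ k ∈ Icc (-((n + 1 : ℕ) : ℤ)) ((n + 1 : ℕ) : ℤ), f k := by
  rw [sum_Icc_neg_succ, sum_Icc_neg_succ n f]
  have h : |(n : ℤ) + 1| = (n : ℤ) + 1 := abs_of_nonneg (by positivity)
  rw [abs_neg, h]
  have h2 : ∑ k ∈ Icc (-(n : ℤ)) (n : ℤ), (((n + 1 : ℕ) : ℝ) + 1 - ((|k| : ℤ) : ℝ)) * f k =
      ∑ k ∈ Icc (-(n : ℤ)) (n : ℤ), ((n : ℝ) + 1 - ((|k| : ℤ) : ℝ)) * f k +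
        ∑ k ∈ Icc (-(n : ℤ)) (n : ℤ), f k := by
    rw [← Finset.sum_add_distrib]
    refine Finset.sum_congr rfl fun k _ => ?_
    push_cast; ring
  rw [h2]
  push_cast
  ring

theorem dirichlet_sum (x : ℝ) (n : ℕ) :
    (2 - 2 * Real.cos x) * ∑ k ∈ Icc (-(n : ℤ)) (n : ℤ), Real.cos (k * x) =
      2 * Real.cos (n * x) - 2 * Real.cos (((n : ℝ) + 1) * x) := by
  induction n with
  | zero => simp
  | succ n ih =>
    rw [sum_Icc_neg_succ, mul_add, mul_add, ih]
    push_cast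
    have h1 : Real.cos ((((n : ℝ) + 1) + 1) * x) =
        Real.cos (((n : ℝ) + 1) * x) * Real.cos x - Real.sin (((n : ℝ) + 1) * x) * Real.sin x := by
      rw [← Real.cos_add]; ring_nf
    have h2 : Real.cos ((n : ℝ) * x) =
        Real.cos (((n : ℝ) + 1) * x) * Real.cos x + Real.sin (((n : ℝ) + 1) * x) * Real.sin x := by
      rw [← Real.cos_sub]; ring_nf
    have h3 : Real.cos (-((n : ℝ) + 1) * x) = Real.cos (((n : ℝ) + 1) * x) := by
      rw [← Real.cos_neg]; ring_nf
    rw [h1, h2]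
    simp only [h3]
    ring

theorem fejer_sum (x : ℝ) (n : ℕ) :
    (2 - 2 * Real.cos x) *
      ∑ k ∈ Icc (-(n : ℤ)) (n : ℤ), ((n : ℝ) + 1 - ((|k| : ℤ) : ℝ)) * Real.cos (k * x) =
      2 - 2 * Real.cos (((n : ℝ) + 1) * x) := by
  induction n with
  | zero => simp
  | succ n ih =>
    rw [sum_Icc_neg_triangle_succ n (fun k => Real.cos (k * x)), mul_add, ih, dirichlet_sum]
    push_cast
    ring

theorem sum_Icc_neg_sq (n : ℕ) :
    ∑ k ∈ Icc (-(n : ℤ)) (n : ℤ), (k : ℝ) ^ 2 = (n : ℝ) * (n + 1) * (2 * n + 1) / 3 := by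
  induction n with
  | zero => simp
  | succ n ih => rw [sum_Icc_neg_succ, ih]; push_cast; ring

theorem sum_Icc_neg_triangle_sq (n : ℕ) :
    ∑ k ∈ Icc (-(n : ℤ)) (n : ℤ), ((n : ℝ) + 1 - ((|k| : ℤ) : ℝ)) * (k : ℝ) ^ 2 =
      (n : ℝ) * (n + 1) ^ 2 * (n + 2) / 6 := by
  induction n with
  | zero => simp
  | succ n ih =>
    rw [sum_Icc_neg_triangle_succ n (fun k => (k : ℝ) ^ 2), ih, sum_Icc_neg_sq]; push_cast; ring

theorem sum_Icc_neg_triangle (n : ℕ) :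
    ∑ k ∈ Icc (-(n : ℤ)) (n : ℤ), ((n : ℝ) + 1 - ((|k| : ℤ) : ℝ)) = ((n : ℝ) + 1) ^ 2 := by
  induction n with
  | zero => simp
  | succ n ih =>
    have h := sum_Icc_neg_triangle_succ n (fun _ => 1)
    simp only [mul_one] at h
    rw [h, ih, Finset.sum_const, Int.card_Icc]
    have h2 : (((n + 1 : ℕ) : ℤ) + 1 - -((n + 1 : ℕ) : ℤ)).toNat = 2 * n + 3 := by omega
    rw [h2]
    simp; ring

theorem sum_fejerCoeff (n : ℕ) : ∑ k ∈ Icc (-(n : ℤ)) (n : ℤ), fejerCoeff n k = 1 := by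
  have : ((n : ℝ) + 1) ≠ 0 := by positivity
  simp only [fejerCoeff_eq]
  rw [← Finset.sum_div, sum_Icc_neg_triangle, div_self (by positivity)]

theorem sum_fejerCoeff_mul_sq (n : ℕ) :
    ∑ k ∈ Icc (-(n : ℤ)) (n : ℤ), fejerCoeff n k * (2 * Real.pi * k) ^ 2 =
      2 / 3 * Real.pi ^ 2 * n * (n + 2) := by
  have h0 : ((n : ℝ) + 1) ≠ 0 := by positivity
  have h : ∀ k : ℤ, fejerCoeff n k * (2 * Real.pi * k) ^ 2 =
      (((n : ℝ) + 1 - ((|k| : ℤ) : ℝ)) * (k : ℝ) ^ 2) * (4 * Real.pi ^ 2 / ((n : ℝ) + 1) ^ 2) := by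
    intro k; rw [fejerCoeff_eq]; field_simp; ring
  simp only [h]
  rw [← Finset.sum_mul, sum_Icc_neg_triangle_sq]
  field_simp
  ring

theorem neg_fejerCurv (n : ℕ) : -fejerCurv n = 2 / 3 * Real.pi ^ 2 * n * (n + 2) := by
  rw [fejerCurv_eq_deriv2, ← sum_fejerCoeff_mul_sq, fejerDeriv2, ← Finset.sum_neg_distrib]
  refine Finset.sum_congr rfl fun k _ => ?_
  simp

/-- The closed form is kept undivided, so that it holds at integers too and can be differentiated as
an identity between functions. -/
theorem fejer_mul_sin_sq (n : ℕ) (t : ℝ) :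
    ((n : ℝ) + 1) ^ 2 * (fejer n t * Real.sin (Real.pi * t) ^ 2) =
      Real.sin (Real.pi * ((n : ℝ) + 1) * t) ^ 2 := by
  have h0 : ((n : ℝ) + 1) ≠ 0 := by positivity
  have h := fejer_sum (2 * (Real.pi * t)) n
  have h1 : fejer n t * ((n : ℝ) + 1) ^ 2 = ∑ k ∈ Icc (-(n : ℤ)) (n : ℤ),
      ((n : ℝ) + 1 - ((|k| : ℤ) : ℝ)) * Real.cos (k * (2 * (Real.pi * t))) := by
    rw [fejer_eq_sum, Finset.sum_mul]
    refine Finset.sum_congr rfl fun k _ => ?_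
    rw [fejerCoeff_eq, show 2 * Real.pi * k * t = k * (2 * (Real.pi * t)) by ring]
    field_simp
  rw [← h1, show ((n : ℝ) + 1) * (2 * (Real.pi * t)) = 2 * (Real.pi * ((n : ℝ) + 1) * t) by ring,
    Real.cos_two_mul, Real.cos_two_mul, Real.cos_sq', Real.cos_sq'] at h
  linarith

/-- The coefficients are even in k, so the imaginary parts cancel in pairs. -/
theorem sum_fejerCoeff_exp (n : ℕ) (t : ℝ) :
    ∑ k ∈ Icc (-(n : ℤ)) (n : ℤ),
      (fejerCoeff n k : ℂ) * Complex.exp (Complex.I * (2 * Real.pi * k * t : ℝ)) =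
      (fejer n t : ℂ) := by
  apply Complex.ext
  · rw [Complex.re_sum, Complex.ofReal_re, fejer_eq_sum]
    refine Finset.sum_congr rfl fun k _ => ?_
    rw [mul_comm Complex.I, Complex.re_ofReal_mul, Complex.exp_ofReal_mul_I_re]
  · rw [Complex.im_sum, Complex.ofReal_im]
    refine sum_Icc_neg_eq_zero_of_odd n _ fun k => ?_
    rw [mul_comm Complex.I, mul_comm Complex.I, Complex.im_ofReal_mul, Complex.im_ofReal_mul,
      Complex.exp_ofReal_mul_I_im, Complex.exp_ofReal_mul_I_im, fejerCoeff_neg, ← mul_neg,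
      ← Real.sin_neg]
    push_cast; ring_nf

theorem sum_fejerCoeff_exp_deriv (n : ℕ) (t : ℝ) :
    ∑ k ∈ Icc (-(n : ℤ)) (n : ℤ),
      (fejerCoeff n k : ℂ) * ((Complex.I * (2 * Real.pi * k : ℝ)) *
        Complex.exp (Complex.I * (2 * Real.pi * k * t : ℝ))) =
      (fejerDeriv n t : ℂ) := by
  have key : ∀ k : ℤ, (fejerCoeff n k : ℂ) * ((Complex.I * (2 * Real.pi * k : ℝ)) *
        Complex.exp (Complex.I * (2 * Real.pi * k * t : ℝ))) =
      ((fejerCoeff n k * (-Real.sin (2 * Real.pi * k * t) * (2 * Real.pi * k)) : ℝ) : ℂ) +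
      ((fejerCoeff n k * (Real.cos (2 * Real.pi * k * t) * (2 * Real.pi * k)) : ℝ) : ℂ) *
        Complex.I := by
    intro k
    rw [mul_comm Complex.I ((2 * Real.pi * k * t : ℝ) : ℂ), Complex.exp_mul_I,
      ← Complex.ofReal_cos, ← Complex.ofReal_sin]
    push_cast
    linear_combination (fejerCoeff n k : ℂ) * 2 * Real.pi * k * Complex.sin (2 * Real.pi * k * t) * Complex.I_sq
  simp only [key]
  rw [Finset.sum_add_distrib, ← Finset.sum_mul, ← Complex.ofReal_sum, ← Complex.ofReal_sum,
    sum_Icc_neg_eq_zero_of_odd n (fun k => fejerCoeff n k *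
      (Real.cos (2 * Real.pi * k * t) * (2 * Real.pi * k)))]
  · simp [fejerDeriv]
  · intro k
    rw [fejerCoeff_neg, ← Real.cos_neg]
    push_cast; ring_nf

/-! ### The gradient as a kernel residual -/

/-- The kernel vector whose `k`-th entry is multiplied by an amplitude at location `x`. -/
noncomputable def atom (n : ℕ) (x : ℝ) (k : ℤ) : ℂ :=
  (psfWeight n k : ℂ) * Complex.exp (-Complex.I * (2 * Real.pi * k * x : ℝ))

theorem observe_eq_sum_atom {r : ℕ} (n : ℕ) (θ : Params r) (k : ℤ) :
    observe n θ k = ∑ l, θ.1 l * atom n (θ.2 l) k := by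
  unfold observe atom
  rw [Finset.mul_sum]
  exact Finset.sum_congr rfl fun l _ => by ring

theorem observe_update_amplitude {r : ℕ} (n : ℕ) (θ : Params r) (j : Fin r) (z : ℂ) (k : ℤ) :
    observe n (Function.update θ.1 j z, θ.2) k =
      observe n θ k + (z - θ.1 j) * atom n (θ.2 j) k := by
  simp only [observe_eq_sum_atom]
  rw [← sub_eq_iff_eq_add', ← Finset.sum_sub_distrib, Finset.sum_eq_single j]
  · simp; ring
  · intro l _ hl; simp [hl]
  · simp

theorem observe_update_location {r : ℕ} (n : ℕ) (θ : Params r) (j : Fin r) (t : ℝ) (k : ℤ) :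
    observe n (θ.1, Function.update θ.2 j t) k =
      observe n θ k + θ.1 j * (atom n t k - atom n (θ.2 j) k) := by
  simp only [observe_eq_sum_atom]
  rw [← sub_eq_iff_eq_add', ← Finset.sum_sub_distrib, Finset.sum_eq_single j]
  · simp; ring
  · intro l _ hl; simp [hl]
  · simp

theorem hasDerivAt_atom (n : ℕ) (k : ℤ) (t : ℝ) :
    HasDerivAt (fun t => atom n t k) (-Complex.I * (2 * Real.pi * k : ℝ) * atom n t k) t := by
  unfold atom
  have h : HasDerivAt (fun t : ℝ => ((2 * Real.pi * k * t : ℝ) : ℂ))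
      ((2 * Real.pi * k : ℝ) : ℂ) t := by
    have := ((hasDerivAt_id t).const_mul (2 * Real.pi * (k : ℝ))).ofReal_comp
    simpa using this
  exact ((h.const_mul (-Complex.I)).cexp.const_mul (psfWeight n k : ℂ)).congr_deriv (by ring)

theorem conj_atom_mul_atom {n : ℕ} {k : ℤ} (hk : k ∈ Icc (-(n : ℤ)) (n : ℤ)) (x y : ℝ) :
    conj (atom n x k) * atom n y k =
      (fejerCoeff n k : ℂ) * Complex.exp (Complex.I * (2 * Real.pi * k * (x - y) : ℝ)) := by
  have h : Complex.exp (Complex.I * (2 * Real.pi * k * (x - y) : ℝ)) =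
      conj (Complex.exp (-Complex.I * (2 * Real.pi * k * x : ℝ))) *
        Complex.exp (-Complex.I * (2 * Real.pi * k * y : ℝ)) := by
    rw [← Complex.exp_conj, ← Complex.exp_add]
    congr 1
    simp only [map_mul, map_neg, Complex.conj_I, Complex.conj_ofReal]
    push_cast; ring
  rw [h, ← psfWeight_sq hk, atom, atom, map_mul, Complex.conj_ofReal]
  push_cast; ring

/-- Kernel interpolation of the spikes `θ` minus that of the spikes `θs`. -/
noncomputable def residual {r : ℕ} (K : ℝ → ℝ) (θs θ : Params r) (x : ℝ) : ℂ :=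
  ∑ l, (θ.1 l * K (x - θ.2 l) - θs.1 l * K (x - θs.2 l))

theorem sum_conj_atom_mul_observe {r : ℕ} (n : ℕ) (θ : Params r) (x : ℝ) :
    ∑ k ∈ Icc (-(n : ℤ)) (n : ℤ), conj (atom n x k) * observe n θ k =
      ∑ l, θ.1 l * fejer n (x - θ.2 l) := by
  simp only [observe_eq_sum_atom, ← sum_fejerCoeff_exp, Finset.mul_sum]
  rw [Finset.sum_comm]
  refine Finset.sum_congr rfl fun l _ => Finset.sum_congr rfl fun k hk => ?_
  rw [← conj_atom_mul_atom hk]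
  ring

theorem sum_conj_atom_deriv_mul_observe {r : ℕ} (n : ℕ) (θ : Params r) (x : ℝ) :
    ∑ k ∈ Icc (-(n : ℤ)) (n : ℤ),
      conj (-Complex.I * (2 * Real.pi * k : ℝ) * atom n x k) * observe n θ k =
      ∑ l, θ.1 l * fejerDeriv n (x - θ.2 l) := by
  simp only [observe_eq_sum_atom, ← sum_fejerCoeff_exp_deriv, Finset.mul_sum]
  rw [Finset.sum_comm]
  refine Finset.sum_congr rfl fun l _ => Finset.sum_congr rfl fun k hk => ?_
  rw [mul_left_comm (fejerCoeff n k : ℂ), ← conj_atom_mul_atom hk, map_mul, map_mul, map_neg,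
    Complex.conj_I, Complex.conj_ofReal]
  ring

/-- The observation is affine in a single amplitude, with slope the atom at its location. The
gradient is thus the correlation of this atom with the misfit, and atoms correlate through the Fejér
kernel. -/
theorem gradLoss_amplitude {r : ℕ} (n : ℕ) (θs θ : Params r) (j : Fin r) :
    (gradLoss n θs θ).1 j = residual (fejer n) θs θ (θ.2 j) := by
  have key : HasGradientAt (𝕜 := ℝ)
      (fun z : ℂ => loss n θs (Function.update θ.1 j z, θ.2))
      (∑ k ∈ Icc (-(n : ℤ)) (n : ℤ),
        conj (atom n (θ.2 j) k) * (observe n θ k - observe n θs k)) (θ.1 j) := by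
    rw [hasGradientAt_iff_hasFDerivAt]
    have h : ∀ k ∈ Icc (-(n : ℤ)) (n : ℤ), HasFDerivAt (𝕜 := ℝ)
        (fun z : ℂ => ‖observe n (Function.update θ.1 j z, θ.2) k - observe n θs k‖ ^ 2)
        (2 • (innerSL ℝ (observe n θ k - observe n θs k)).comp
          (atom n (θ.2 j) k • ContinuousLinearMap.id ℝ ℂ)) (θ.1 j) := by
      intro k _
      simp only [observe_update_amplitude]
      have h := (((((hasFDerivAt_id (𝕜 := ℝ) (θ.1 j)).sub_const (θ.1 j)).mul_const
        (atom n (θ.2 j) k)).const_add (observe n θ k)).sub_const (observe n θs k)).norm_sq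
      simpa using h
    refine ((HasFDerivAt.fun_sum h).const_mul (1 / 2)).congr_fderiv
      (ContinuousLinearMap.ext fun v => ?_)
    rw [InnerProductSpace.toDual_apply_apply, sum_inner, smul_apply,
      _root_.sum_apply, Finset.smul_sum]
    refine Finset.sum_congr rfl fun k _ => ?_
    simp [Complex.inner]
    ring
  have h2 : (gradLoss n θs θ).1 j = _ := key.gradient
  rw [h2]
  simp only [mul_sub, Finset.sum_sub_distrib, residual, sum_conj_atom_mul_observe]

theorem gradLoss_location {r : ℕ} (n : ℕ) (θs θ : Params r) (j : Fin r) :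
    (gradLoss n θs θ).2 j = (conj (θ.1 j) * residual (fejerDeriv n) θs θ (θ.2 j)).re := by
  have key : HasDerivAt (fun t : ℝ => loss n θs (θ.1, Function.update θ.2 j t))
      ((1 / 2) * ∑ k ∈ Icc (-(n : ℤ)) (n : ℤ), 2 * inner ℝ (observe n θ k - observe n θs k)
        (θ.1 j * (-Complex.I * (2 * Real.pi * k : ℝ) * atom n (θ.2 j) k))) (θ.2 j) := by
    refine (HasDerivAt.fun_sum fun k _ => ?_).const_mul (1 / 2)
    simp only [observe_update_location]
    have h := (((((hasDerivAt_atom n k (θ.2 j)).sub_const (atom n (θ.2 j) k)).const_mul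
      (θ.1 j)).const_add (observe n θ k)).sub_const (observe n θs k)).norm_sq
    simpa using h
  have h2 : (gradLoss n θs θ).2 j = _ := key.deriv
  rw [h2]
  simp only [residual, Finset.sum_sub_distrib, ← sum_conj_atom_deriv_mul_observe]
  rw [← Finset.sum_sub_distrib, Finset.mul_sum, Finset.mul_sum, Complex.re_sum]
  refine Finset.sum_congr rfl fun k _ => ?_
  rw [Complex.inner, ← mul_sub, ← Complex.conj_re (conj (θ.1 j) * _)]
  simp only [map_mul, Complex.conj_conj]
  ring_nf

/-! ### The kernel near the origin -/

theorem one_sub_fejer_nonneg (n : ℕ) (t : ℝ) : 0 ≤ 1 - fejer n t := by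
  rw [fejer_eq_sum, ← sum_fejerCoeff n, ← Finset.sum_sub_distrib]
  refine Finset.sum_nonneg fun k hk => ?_
  nlinarith [fejerCoeff_nonneg hk, Real.cos_le_one (2 * Real.pi * k * t)]

theorem one_sub_fejer_le (n : ℕ) (t : ℝ) : 1 - fejer n t ≤ -fejerCurv n * t ^ 2 / 2 := by
  rw [fejer_eq_sum, ← sum_fejerCoeff n, ← Finset.sum_sub_distrib, neg_fejerCurv,
    ← sum_fejerCoeff_mul_sq, Finset.sum_mul, Finset.sum_div]
  refine Finset.sum_le_sum fun k hk => ?_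
  nlinarith [mul_le_mul_of_nonneg_left (Real.one_sub_sq_div_two_le_cos (x := 2 * Real.pi * k * t))
    (fejerCoeff_nonneg hk)]

/-- The bound |x - sin x| ≤ |x|³/6 at each frequency leaves a fourth moment. Since |k| ≤ n, (2πk)²/6
is at most -F''(0); spending two of the four powers this way leaves the second moment, which is
again -F''(0). -/
theorem abs_fejerDeriv_sub_linear_le (n : ℕ) (t : ℝ) :
    |fejerDeriv n t - fejerCurv n * t| ≤ (fejerCurv n) ^ 2 * |t| ^ 3 := by
  have h1 : fejerDeriv n t - fejerCurv n * t = ∑ k ∈ Icc (-(n : ℤ)) (n : ℤ),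
      fejerCoeff n k * ((2 * Real.pi * k) *
        (2 * Real.pi * k * t - Real.sin (2 * Real.pi * k * t))) := by
    rw [← neg_neg (fejerCurv n), neg_fejerCurv, ← sum_fejerCoeff_mul_sq, fejerDeriv, neg_mul,
      sub_neg_eq_add, Finset.sum_mul, ← Finset.sum_add_distrib]
    exact Finset.sum_congr rfl fun k _ => by ring
  have h2 : (fejerCurv n) ^ 2 * |t| ^ 3 = ∑ k ∈ Icc (-(n : ℤ)) (n : ℤ),
      (fejerCoeff n k * (2 * Real.pi * k) ^ 2) * (-fejerCurv n * |t| ^ 3) := by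
    rw [← Finset.sum_mul, sum_fejerCoeff_mul_sq, ← neg_fejerCurv]
    ring
  rw [h1, h2]
  refine (Finset.abs_sum_le_sum_abs _ _).trans (Finset.sum_le_sum fun k hk => ?_)
  have hc := fejerCoeff_nonneg hk
  rw [abs_mul, abs_mul, abs_of_nonneg hc, mul_assoc (fejerCoeff n k)]
  refine mul_le_mul_of_nonneg_left ?_ hc
  have hk2 : (k : ℝ) ^ 2 ≤ (n : ℝ) ^ 2 := by
    have h : |k| ≤ (n : ℤ) := abs_le.2 (mem_Icc.1 hk)
    have h' : |(k : ℝ)| ≤ (n : ℝ) := by exact_mod_cast h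
    exact sq_le_sq' (by linarith [neg_abs_le (k : ℝ)]) ((le_abs_self _).trans h')
  have hcurv : (2 * Real.pi * k) ^ 2 / 6 ≤ -fejerCurv n := by
    rw [neg_fejerCurv]
    have : Real.pi ^ 2 * (k : ℝ) ^ 2 ≤ Real.pi ^ 2 * (n : ℝ) ^ 2 := by gcongr
    have h0 : 0 ≤ Real.pi ^ 2 * (n : ℝ) := by positivity
    nlinarith
  calc |2 * Real.pi * k| * |2 * Real.pi * k * t - Real.sin (2 * Real.pi * k * t)|
      ≤ |2 * Real.pi * k| * (|2 * Real.pi * k * t| ^ 3 / 6) := by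
        gcongr; exact Real.abs_sub_sin_le _
    _ = |2 * Real.pi * k| ^ 2 * (|2 * Real.pi * k| ^ 2 / 6 * |t| ^ 3) := by
        rw [abs_mul (2 * Real.pi * k) t]; ring
    _ ≤ _ := by rw [sq_abs]; gcongr

/-! ### Decay of the kernel away from the integers -/

/-- Differentiating the undivided closed form on both sides and using uniqueness of derivatives; one
more differentiation gives the analogue for `fejerDeriv2`. -/
theorem fejerDeriv_mul_sin_sq (n : ℕ) (t : ℝ) :
    ((n : ℝ) + 1) ^ 2 * (fejerDeriv n t * Real.sin (Real.pi * t) ^ 2 +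
        fejer n t * (2 * Real.pi * (Real.sin (Real.pi * t) * Real.cos (Real.pi * t)))) =
      2 * Real.pi * ((n : ℝ) + 1) *
        (Real.sin (Real.pi * ((n : ℝ) + 1) * t) * Real.cos (Real.pi * ((n : ℝ) + 1) * t)) := by
  have hs : ∀ c : ℝ, HasDerivAt (fun t => Real.sin (c * t)) (Real.cos (c * t) * c) t := fun c => by
    simpa using ((hasDerivAt_id t).const_mul c).sin
  have h1 := ((hasDerivAt_fejer n t).fun_mul ((hs Real.pi).fun_pow 2)).const_mul (((n : ℝ) + 1) ^ 2)
  simp only [fejer_mul_sin_sq] at h1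
  have h2 := (hs (Real.pi * ((n : ℝ) + 1))).fun_pow 2
  have h := h1.unique h2
  simp only [Nat.cast_ofNat, Nat.add_one_sub_one, pow_one] at h
  linear_combination h

theorem fejerDeriv2_mul_sin_sq (n : ℕ) (t : ℝ) :
    ((n : ℝ) + 1) ^ 2 * (fejerDeriv2 n t * Real.sin (Real.pi * t) ^ 2 +
        4 * Real.pi * fejerDeriv n t * (Real.sin (Real.pi * t) * Real.cos (Real.pi * t)) +
        2 * Real.pi ^ 2 * fejer n t * (Real.cos (Real.pi * t) ^ 2 - Real.sin (Real.pi * t) ^ 2)) =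
      2 * Real.pi ^ 2 * ((n : ℝ) + 1) ^ 2 *
        (Real.cos (Real.pi * ((n : ℝ) + 1) * t) ^ 2 -
          Real.sin (Real.pi * ((n : ℝ) + 1) * t) ^ 2) := by
  have hs : ∀ c : ℝ, HasDerivAt (fun t => Real.sin (c * t)) (Real.cos (c * t) * c) t := fun c => by
    simpa using ((hasDerivAt_id t).const_mul c).sin
  have hc : ∀ c : ℝ, HasDerivAt (fun t => Real.cos (c * t)) (-Real.sin (c * t) * c) t := fun c => by
    simpa using ((hasDerivAt_id t).const_mul c).cos
  have h1 := (((hasDerivAt_fejerDeriv n t).fun_mul ((hs Real.pi).fun_pow 2)).fun_add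
    ((hasDerivAt_fejer n t).fun_mul (((hs Real.pi).fun_mul (hc Real.pi)).const_mul
      (2 * Real.pi)))).const_mul (((n : ℝ) + 1) ^ 2)
  simp only [fejerDeriv_mul_sin_sq] at h1
  have h2 := ((hs (Real.pi * ((n : ℝ) + 1))).fun_mul (hc (Real.pi * ((n : ℝ) + 1)))).const_mul
    (2 * Real.pi * ((n : ℝ) + 1))
  have h := h1.unique h2
  simp only [Nat.cast_ofNat, Nat.add_one_sub_one, pow_one] at h
  linear_combination h

theorem abs_sin_mul_cos_le (x : ℝ) : |Real.sin x * Real.cos x| ≤ 1 / 2 := by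
  rw [abs_le]
  constructor <;> nlinarith [Real.sin_sq_add_cos_sq x, sq_nonneg (Real.sin x - Real.cos x),
    sq_nonneg (Real.sin x + Real.cos x)]

theorem abs_cos_sq_sub_sin_sq_le (x : ℝ) : |Real.cos x ^ 2 - Real.sin x ^ 2| ≤ 1 := by
  rw [abs_le]
  constructor <;> nlinarith [Real.sin_sq_add_cos_sq x, sq_nonneg (Real.sin x),
    sq_nonneg (Real.cos x)]

theorem abs_fejer_mul_le {n : ℕ} {t V : ℝ} (hV : V = ((n : ℝ) + 1) * |Real.sin (Real.pi * t)|) :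
    |fejer n t| * V ^ 2 ≤ 1 := by
  have h := fejer_mul_sin_sq n t
  have h1 : |fejer n t| * V ^ 2 = |((n : ℝ) + 1) ^ 2 * (fejer n t * Real.sin (Real.pi * t) ^ 2)| := by
    rw [abs_mul, abs_mul, abs_of_nonneg (by positivity : 0 ≤ ((n : ℝ) + 1) ^ 2), abs_pow, hV]; ring
  rw [h1, h, abs_of_nonneg (by positivity)]
  exact Real.sin_sq_le_one _

theorem abs_fejerDeriv_mul_le {n : ℕ} {t V : ℝ}
    (hV : V = ((n : ℝ) + 1) * |Real.sin (Real.pi * t)|) :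
    |fejerDeriv n t| * V ^ 3 ≤ Real.pi * ((n : ℝ) + 1) * (V + 2) := by
  have hV0 : 0 ≤ V := by rw [hV]; positivity
  have h := fejerDeriv_mul_sin_sq n t
  have hF := abs_fejer_mul_le hV
  have h1 : |fejerDeriv n t| * V ^ 2 ≤
      Real.pi * ((n : ℝ) + 1) + 2 * Real.pi * ((n : ℝ) + 1) * (|fejer n t| * V) := by
    have e : |fejerDeriv n t| * V ^ 2 =
        |2 * Real.pi * ((n : ℝ) + 1) *
          (Real.sin (Real.pi * ((n : ℝ) + 1) * t) * Real.cos (Real.pi * ((n : ℝ) + 1) * t)) -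
        2 * Real.pi * ((n : ℝ) + 1) ^ 2 *
          (fejer n t * Real.sin (Real.pi * t) * Real.cos (Real.pi * t))| := by
      rw [← h, hV, mul_pow, ← abs_pow]
      rw [← abs_of_nonneg (by positivity : 0 ≤ ((n : ℝ) + 1) ^ 2), ← abs_mul, ← abs_mul]
      rw [abs_of_nonneg (by positivity : 0 ≤ ((n : ℝ) + 1) ^ 2)]
      congr 1; ring
    rw [e]
    refine (abs_sub _ _).trans (add_le_add ?_ ?_)
    · rw [abs_mul, abs_of_nonneg (by positivity : 0 ≤ 2 * Real.pi * ((n : ℝ) + 1))]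
      calc _ ≤ 2 * Real.pi * ((n : ℝ) + 1) * (1 / 2) := by gcongr; exact abs_sin_mul_cos_le _
        _ = _ := by ring
    · rw [abs_mul, abs_of_nonneg (by positivity : 0 ≤ 2 * Real.pi * ((n : ℝ) + 1) ^ 2), abs_mul,
        abs_mul]
      calc _ ≤ 2 * Real.pi * ((n : ℝ) + 1) ^ 2 * (|fejer n t| * |Real.sin (Real.pi * t)| * 1) := by
            gcongr; exact Real.abs_cos_le_one _
        _ = _ := by rw [hV]; ring
  calc |fejerDeriv n t| * V ^ 3 = |fejerDeriv n t| * V ^ 2 * V := by ring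
    _ ≤ (Real.pi * ((n : ℝ) + 1) + 2 * Real.pi * ((n : ℝ) + 1) * (|fejer n t| * V)) * V := by gcongr
    _ = Real.pi * ((n : ℝ) + 1) * (V + 2 * (|fejer n t| * V ^ 2)) := by ring
    _ ≤ Real.pi * ((n : ℝ) + 1) * (V + 2 * 1) := by gcongr
    _ = _ := by ring

theorem abs_fejerDeriv2_mul_le {n : ℕ} {t V : ℝ}
    (hV : V = ((n : ℝ) + 1) * |Real.sin (Real.pi * t)|) :
    |fejerDeriv2 n t| * V ^ 4 ≤ 2 * Real.pi ^ 2 * ((n : ℝ) + 1) ^ 2 * (V ^ 2 + 2 * V + 5) := by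
  have hV0 : 0 ≤ V := by rw [hV]; positivity
  have h := fejerDeriv2_mul_sin_sq n t
  have hF := abs_fejer_mul_le hV
  have hF1 := abs_fejerDeriv_mul_le hV
  have h1 : |fejerDeriv2 n t| * V ^ 2 ≤ 2 * Real.pi ^ 2 * ((n : ℝ) + 1) ^ 2 +
      4 * Real.pi * ((n : ℝ) + 1) * (|fejerDeriv n t| * V) +
      2 * Real.pi ^ 2 * ((n : ℝ) + 1) ^ 2 * |fejer n t| := by
    have e : |fejerDeriv2 n t| * V ^ 2 =
        |2 * Real.pi ^ 2 * ((n : ℝ) + 1) ^ 2 * (Real.cos (Real.pi * ((n : ℝ) + 1) * t) ^ 2 -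
          Real.sin (Real.pi * ((n : ℝ) + 1) * t) ^ 2) -
        4 * Real.pi * ((n : ℝ) + 1) ^ 2 *
          (fejerDeriv n t * Real.sin (Real.pi * t) * Real.cos (Real.pi * t)) -
        2 * Real.pi ^ 2 * ((n : ℝ) + 1) ^ 2 *
          (fejer n t * (Real.cos (Real.pi * t) ^ 2 - Real.sin (Real.pi * t) ^ 2))| := by
      rw [← h, hV, mul_pow, ← abs_pow]
      rw [← abs_of_nonneg (by positivity : 0 ≤ ((n : ℝ) + 1) ^ 2), ← abs_mul, ← abs_mul]
      rw [abs_of_nonneg (by positivity : 0 ≤ ((n : ℝ) + 1) ^ 2)]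
      congr 1; ring
    rw [e]
    refine (abs_sub _ _).trans (add_le_add ((abs_sub _ _).trans (add_le_add ?_ ?_)) ?_)
    · rw [abs_mul, abs_of_nonneg (by positivity : 0 ≤ 2 * Real.pi ^ 2 * ((n : ℝ) + 1) ^ 2)]
      exact mul_le_of_le_one_right (by positivity) (abs_cos_sq_sub_sin_sq_le _)
    · rw [abs_mul, abs_of_nonneg (by positivity : 0 ≤ 4 * Real.pi * ((n : ℝ) + 1) ^ 2), abs_mul,
        abs_mul]
      calc _ ≤ 4 * Real.pi * ((n : ℝ) + 1) ^ 2 *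
              (|fejerDeriv n t| * |Real.sin (Real.pi * t)| * 1) := by
            gcongr; exact Real.abs_cos_le_one _
        _ = _ := by rw [hV]; ring
    · rw [abs_mul, abs_of_nonneg (by positivity : 0 ≤ 2 * Real.pi ^ 2 * ((n : ℝ) + 1) ^ 2), abs_mul]
      gcongr
      exact mul_le_of_le_one_right (by positivity) (abs_cos_sq_sub_sin_sq_le _)
  calc |fejerDeriv2 n t| * V ^ 4 = |fejerDeriv2 n t| * V ^ 2 * V ^ 2 := by ring
    _ ≤ (2 * Real.pi ^ 2 * ((n : ℝ) + 1) ^ 2 +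
      4 * Real.pi * ((n : ℝ) + 1) * (|fejerDeriv n t| * V) +
      2 * Real.pi ^ 2 * ((n : ℝ) + 1) ^ 2 * |fejer n t|) * V ^ 2 := by gcongr
    _ = 2 * Real.pi ^ 2 * ((n : ℝ) + 1) ^ 2 * V ^ 2 +
      4 * Real.pi * ((n : ℝ) + 1) * (|fejerDeriv n t| * V ^ 3) +
      2 * Real.pi ^ 2 * ((n : ℝ) + 1) ^ 2 * (|fejer n t| * V ^ 2) := by ring
    _ ≤ 2 * Real.pi ^ 2 * ((n : ℝ) + 1) ^ 2 * V ^ 2 +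
      4 * Real.pi * ((n : ℝ) + 1) * (Real.pi * ((n : ℝ) + 1) * (V + 2)) +
      2 * Real.pi ^ 2 * ((n : ℝ) + 1) ^ 2 * 1 := by gcongr
    _ = _ := by ring

/-- Jordan's inequality, after reducing t modulo 1 to [-1/2, 1/2]. -/
theorem two_mul_abs_sub_round_le_abs_sin (t : ℝ) :
    2 * |t - round t| ≤ |Real.sin (Real.pi * t)| := by
  have h1 : |Real.sin (Real.pi * t)| = |Real.sin (Real.pi * (t - round t))| := by
    rw [show Real.pi * (t - round t) = Real.pi * t - (round t : ℤ) * Real.pi by ring,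
      Real.sin_sub_int_mul_pi, abs_mul, abs_zpow]
    simp
  have h2 := abs_sub_round t
  have hpi := Real.pi_pos
  have h3 : |Real.pi * (t - round t)| = Real.pi * |t - round t| := by
    rw [abs_mul, abs_of_pos hpi]
  rw [h1, Real.abs_sin_eq_sin_abs_of_abs_le_pi (by rw [h3]; nlinarith), h3]
  have h := Real.mul_le_sin (x := Real.pi * |t - round t|) (by positivity) (by nlinarith)
  calc 2 * |t - round t| = 2 / Real.pi * (Real.pi * |t - round t|) := by field_simp
    _ ≤ _ := h

/-- For n ≥ 2, n(n+2) = (n+1)² - 1 is at least 8/9 of (n+1)², and (2/3)(8/9)·9.85 > 5.8. -/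
theorem neg_fejerCurv_ge {n : ℕ} (hn : 2 ≤ n) : 5.8 * ((n : ℝ) + 1) ^ 2 ≤ -fejerCurv n := by
  rw [neg_fejerCurv]
  have hn' : (2 : ℝ) ≤ n := by exact_mod_cast hn
  have hpi : 9.85 ≤ Real.pi ^ 2 := by nlinarith [Real.pi_gt_d2]
  have h : 9.85 * ((n : ℝ) * (n + 2)) ≤ Real.pi ^ 2 * ((n : ℝ) * (n + 2)) := by gcongr
  nlinarith

theorem sqrt_neg_fejerCurv_ge {n : ℕ} (hn : 2 ≤ n) :
    2.4 * ((n : ℝ) + 1) ≤ √(-fejerCurv n) := by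
  refine Real.le_sqrt_of_sq_le (le_trans ?_ (neg_fejerCurv_ge hn))
  nlinarith [sq_nonneg ((n : ℝ) + 1)]

section Tail

variable {n : ℕ} {x t : ℝ}

/-- Jordan's inequality gives 2(q - 0.16) with q the scaled wrapped distance of x, and 0.32 ≤ 0.07 q
once q ≥ 4.8. -/
theorem tail_sin_bound (hx : 4.8 ≤ ((n : ℝ) + 1) * |x - round x|)
    (ht : ((n : ℝ) + 1) * |t - x| ≤ 0.16) :
    1.93 * (((n : ℝ) + 1) * |x - round x|) ≤ ((n : ℝ) + 1) * |Real.sin (Real.pi * t)| := by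
  have h1 : |x - round x| ≤ |t - round t| + |t - x| := by
    refine (round_le x (round t)).trans ?_
    rw [show x - round t = (t - round t) - (t - x) by ring]
    exact abs_sub _ _
  have h2 := two_mul_abs_sub_round_le_abs_sin t
  have hM : 0 < (n : ℝ) + 1 := by positivity
  have h3 := mul_le_mul_of_nonneg_left h1 hM.le
  have h4 := mul_le_mul_of_nonneg_left h2 hM.le
  linarith

theorem abs_fejer_tail_le (hx : 4.8 ≤ ((n : ℝ) + 1) * |x - round x|)
    (ht : ((n : ℝ) + 1) * |t - x| ≤ 0.16) :
    |fejer n t| ≤ 0.3 / (((n : ℝ) + 1) * |x - round x|) ^ 2 := by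
  have hV := tail_sin_bound hx ht
  set q := ((n : ℝ) + 1) * |x - round x|
  obtain ⟨V, hV'⟩ : ∃ V, V = ((n : ℝ) + 1) * |Real.sin (Real.pi * t)| := ⟨_, rfl⟩
  rw [← hV'] at hV
  have h := abs_fejer_mul_le hV'
  rw [le_div_iff₀ (by positivity)]
  have h2 : (1.93 * q) ^ 2 ≤ V ^ 2 := by gcongr
  have h3 := mul_le_mul_of_nonneg_left h2 (abs_nonneg (fejer n t))
  nlinarith

theorem abs_fejerDeriv_tail_le (hn : 2 ≤ n) (hx : 4.8 ≤ ((n : ℝ) + 1) * |x - round x|)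
    (ht : ((n : ℝ) + 1) * |t - x| ≤ 0.16) :
    |fejerDeriv n t| ≤ 0.5 * √(-fejerCurv n) / (((n : ℝ) + 1) * |x - round x|) ^ 2 := by
  have hV := tail_sin_bound hx ht
  set q := ((n : ℝ) + 1) * |x - round x|
  obtain ⟨V, hV'⟩ : ∃ V, V = ((n : ℝ) + 1) * |Real.sin (Real.pi * t)| := ⟨_, rfl⟩
  rw [← hV'] at hV
  have hV1 : 9.26 ≤ V := by linarith
  have h := abs_fejerDeriv_mul_le hV'
  have hs := sqrt_neg_fejerCurv_ge hn
  rw [le_div_iff₀ (by positivity)]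
  have h2 : (1.93 * q) ^ 2 ≤ V ^ 2 := by gcongr
  have h3 := mul_le_mul_of_nonneg_left h2 (abs_nonneg (fejerDeriv n t))
  have h4 : |fejerDeriv n t| * V ^ 2 ≤ 3.87 * ((n : ℝ) + 1) := by
    -- V ≥ 9.26 absorbs the lower-order term: 2 ≤ 0.22 V. Only the decay V⁻² is kept.
    have hpi : Real.pi * ((n : ℝ) + 1) * (V + 2) ≤ 3.15 * ((n : ℝ) + 1) * (1.22 * V) := by
      gcongr
      · exact Real.pi_lt_d2.le
      · linarith
    have : (|fejerDeriv n t| * V ^ 2) * V ≤ 3.87 * ((n : ℝ) + 1) * V := by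
      have : 0 ≤ ((n : ℝ) + 1) * V := by positivity
      nlinarith
    exact le_of_mul_le_mul_right this (by linarith)
  nlinarith

theorem abs_fejerDeriv2_tail_le (hn : 2 ≤ n) (hx : 4.8 ≤ ((n : ℝ) + 1) * |x - round x|)
    (ht : ((n : ℝ) + 1) * |t - x| ≤ 0.16) :
    |fejerDeriv2 n t| ≤ 1.3 * √(-fejerCurv n) ^ 2 / (((n : ℝ) + 1) * |x - round x|) ^ 2 := by
  have hV := tail_sin_bound hx ht
  set q := ((n : ℝ) + 1) * |x - round x|
  obtain ⟨V, hV'⟩ : ∃ V, V = ((n : ℝ) + 1) * |Real.sin (Real.pi * t)| := ⟨_, rfl⟩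
  rw [← hV'] at hV
  have hV1 : 9.26 ≤ V := by linarith
  have h := abs_fejerDeriv2_mul_le hV'
  have hs := neg_fejerCurv_ge hn
  have hs0 : 0 ≤ -fejerCurv n := le_trans (by positivity) hs
  rw [le_div_iff₀ (by positivity), Real.sq_sqrt hs0]
  have h2 : (1.93 * q) ^ 2 ≤ V ^ 2 := by gcongr
  have h3 := mul_le_mul_of_nonneg_left h2 (abs_nonneg (fejerDeriv2 n t))
  have h4 : |fejerDeriv2 n t| * V ^ 2 ≤ 25.5 * ((n : ℝ) + 1) ^ 2 := by
    have hpi : Real.pi ^ 2 ≤ 9.93 := by nlinarith [Real.pi_lt_d2, Real.pi_pos]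
    have hb : 2 * Real.pi ^ 2 * ((n : ℝ) + 1) ^ 2 * (V ^ 2 + 2 * V + 5) ≤
        2 * 9.93 * ((n : ℝ) + 1) ^ 2 * (1.28 * V ^ 2) := by
      gcongr
      nlinarith
    have : (|fejerDeriv2 n t| * V ^ 2) * V ^ 2 ≤ 25.5 * ((n : ℝ) + 1) ^ 2 * V ^ 2 := by
      have : 0 ≤ ((n : ℝ) + 1) ^ 2 * V ^ 2 := by positivity
      nlinarith
    exact le_of_mul_le_mul_right this (by positivity)
  nlinarith

end Tail

/-! ### Inverse-square sums over separated points -/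

/-- By separation, i ↦ ⌊x i / D⌋ is injective into the positive integers, so the sum is dominated by
Basel's series. -/
theorem sum_inv_sq_le_of_pos {ι : Type*} (s : Finset ι) (x : ι → ℝ) {D : ℝ} (hD : 0 < D)
    (hx : ∀ i ∈ s, D ≤ x i) (hsep : ∀ i ∈ s, ∀ j ∈ s, i ≠ j → D ≤ |x i - x j|) :
    ∑ i ∈ s, 1 / x i ^ 2 ≤ Real.pi ^ 2 / 6 / D ^ 2 := by
  classical
  have hinj : Set.InjOn (fun i => ⌊x i / D⌋₊) s := by
    intro i hi j hj hij
    by_contra hne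
    have h1 := hsep i hi j hj hne
    have hi0 : 0 ≤ x i / D := div_nonneg (hD.le.trans (hx i hi)) hD.le
    have hj0 : 0 ≤ x j / D := div_nonneg (hD.le.trans (hx j hj)) hD.le
    have a1 := Nat.floor_le hi0
    have a2 := Nat.lt_floor_add_one (x i / D)
    have b1 := Nat.floor_le hj0
    have b2 := Nat.lt_floor_add_one (x j / D)
    simp only at hij
    rw [hij] at a1 a2
    have : |x i / D - x j / D| < 1 := by rw [abs_lt]; constructor <;> linarith
    rw [← sub_div, abs_div, abs_of_pos hD, div_lt_one hD] at this
    linarith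
  calc ∑ i ∈ s, 1 / x i ^ 2 ≤ ∑ i ∈ s, 1 / ((⌊x i / D⌋₊ : ℕ) : ℝ) ^ 2 / D ^ 2 := by
        refine Finset.sum_le_sum fun i hi => ?_
        have hxi := hx i hi
        have h1 : 1 ≤ ⌊x i / D⌋₊ := Nat.one_le_floor_iff _ |>.2 ((one_le_div hD).2 hxi)
        have h1' : (1 : ℝ) ≤ ((⌊x i / D⌋₊ : ℕ) : ℝ) := by exact_mod_cast h1
        have h2 := Nat.floor_le (div_nonneg (hD.le.trans hxi) hD.le)
        rw [le_div_iff₀ hD] at h2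
        rw [div_div, ← mul_pow]
        gcongr
    _ = (∑ m ∈ s.image fun i => ⌊x i / D⌋₊, 1 / (m : ℝ) ^ 2) / D ^ 2 := by
        rw [Finset.sum_image hinj, Finset.sum_div]
    _ ≤ _ := by
        gcongr
        exact sum_le_hasSum _ (fun _ _ => by positivity) hasSum_zeta_two

theorem sum_inv_sq_le {ι : Type*} (s : Finset ι) (x : ι → ℝ) {D : ℝ} (hD : 0 < D)
    (hx : ∀ i ∈ s, D ≤ |x i|) (hsep : ∀ i ∈ s, ∀ j ∈ s, i ≠ j → D ≤ |x i - x j|) :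
    ∑ i ∈ s, 1 / x i ^ 2 ≤ Real.pi ^ 2 / 3 / D ^ 2 := by
  classical
  rw [← Finset.sum_filter_add_sum_filter_not s (fun i => 0 ≤ x i)]
  have h1 := sum_inv_sq_le_of_pos (s.filter fun i => 0 ≤ x i) x hD
    (fun i hi => by
      have := hx i (mem_filter.1 hi).1
      rwa [abs_of_nonneg (mem_filter.1 hi).2] at this)
    (fun i hi j hj => hsep i (mem_filter.1 hi).1 j (mem_filter.1 hj).1)
  have h2 := sum_inv_sq_le_of_pos (s.filter fun i => ¬ 0 ≤ x i) (fun i => -x i) hD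
    (fun i hi => by
      have := hx i (mem_filter.1 hi).1
      rwa [abs_of_neg (not_le.1 (mem_filter.1 hi).2)] at this)
    (fun i hi j hj hij => by
      rw [neg_sub_neg, abs_sub_comm]
      exact hsep i (mem_filter.1 hi).1 j (mem_filter.1 hj).1 hij)
  simp only [neg_sq] at h2
  calc _ ≤ Real.pi ^ 2 / 6 / D ^ 2 + Real.pi ^ 2 / 6 / D ^ 2 := add_le_add h1 h2
    _ = _ := by ring

/-- The signed representatives of τ_j - τ_l nearest to 0 differ by τ_l' - τ_l plus an integer, so
they inherit the separation D on the line. -/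
theorem sum_inv_sq_wrap_le {r : ℕ} (τ : Fin r → ℝ) {D : ℝ} (hD : 0 < D)
    (hsep : ∀ l l', l ≠ l' → ∀ p : ℤ, D ≤ |τ l - τ l' + p|) (j : Fin r) :
    ∑ l ∈ univ.erase j, 1 / |τ j - τ l - round (τ j - τ l)| ^ 2 ≤ Real.pi ^ 2 / 3 / D ^ 2 := by
  simp only [sq_abs]
  refine sum_inv_sq_le _ (fun l => τ j - τ l - round (τ j - τ l)) hD (fun l hl => ?_)
    fun l _ l' _ hll => ?_
  · simpa [sub_eq_add_neg] using hsep j l (ne_of_mem_erase hl).symm (-round (τ j - τ l))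
  · have h := hsep l' l hll.symm (round (τ j - τ l') - round (τ j - τ l))
    push_cast at h
    convert h using 2
    ring

/-! ### Dynamic range, separation and γ -/

theorem ampMin_le {r : ℕ} (a : Fin r → ℂ) (j : Fin r) : ampMin a ≤ ‖a j‖ :=
  ciInf_le (Set.finite_range _).bddBelow j

theorem ampMin_pos {r : ℕ} (hr : 1 ≤ r) {a : Fin r → ℂ} (ha : ∀ j, a j ≠ 0) : 0 < ampMin a := by
  have : Nonempty (Fin r) := ⟨⟨0, hr⟩⟩
  obtain ⟨j, hj⟩ := exists_eq_ciInf_of_finite (f := fun l => ‖a l‖)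
  rw [ampMin, ← hj]
  exact norm_pos_iff.2 (ha j)

theorem norm_le_dynamicRange_mul {r : ℕ} (hr : 1 ≤ r) {a : Fin r → ℂ} (ha : ∀ j, a j ≠ 0)
    (l j : Fin r) : ‖a l‖ ≤ ‖a‖ / ampMin a * ‖a j‖ := by
  have h := ampMin_pos hr ha
  rw [div_mul_eq_mul_div, le_div_iff₀ h]
  have := norm_le_pi_norm a l
  have := ampMin_le a j
  gcongr

theorem one_le_dynamicRange {r : ℕ} (hr : 1 ≤ r) {a : Fin r → ℂ} (ha : ∀ j, a j ≠ 0) :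
    1 ≤ ‖a‖ / ampMin a := by
  have h := norm_le_dynamicRange_mul hr ha ⟨0, hr⟩ ⟨0, hr⟩
  have h0 : 0 < ‖a ⟨0, hr⟩‖ := norm_pos_iff.2 (ha _)
  by_contra hlt
  nlinarith

/-- A separation bound `D` realizing `γ`, available as soon as there are two distinct spikes. -/
theorem exists_separation {r n : ℕ} (hr : 1 ≤ r) {θs : Params r} (ha : ∀ j, θs.1 j ≠ 0)
    (hγ : gammaConst n θs < 1 / 2) {i i' : Fin r} (hi : i ≠ i') :
    ∃ D : ℝ, 0 < D ∧ (∀ l l', l ≠ l' → ∀ p : ℤ, D ≤ |θs.2 l - θs.2 l' + p|) ∧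
      (gammaConst n θs).toReal = 11.60 * (‖θs.1‖ / ampMin θs.1) / (((n : ℝ) + 1) * D) ^ 2 := by
  have hκ := one_le_dynamicRange hr ha
  have hle : ∀ l l', l ≠ l' → ∀ p : ℤ,
      wrapSep θs.2 ≤ ENNReal.ofReal |θs.2 l - θs.2 l' + p| := fun l l' h p =>
    iInf_le_of_le l (iInf_le_of_le l' (iInf_le_of_le h (iInf_le _ p)))
  have htop : wrapSep θs.2 ≠ ⊤ := ne_top_of_le_ne_top ENNReal.ofReal_ne_top (hle i i' hi 0)
  have hzero : wrapSep θs.2 ≠ 0 := by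
    -- A zero separation would make γ infinite, because its prefactor is nonzero.
    intro h
    have hpos : ENNReal.ofReal (11.60 * (‖θs.1‖ / ampMin θs.1)) ≠ 0 := by
      rw [ne_eq, ENNReal.ofReal_eq_zero, not_le]; positivity
    rw [gammaConst, h] at hγ
    simp [ENNReal.mul_top hpos] at hγ
  refine ⟨(wrapSep θs.2).toReal, ENNReal.toReal_pos hzero htop, fun l l' h p => ?_, ?_⟩
  · exact ENNReal.toReal_le_of_le_ofReal (abs_nonneg _) (hle l l' h p)
  · rw [gammaConst, ENNReal.toReal_mul, ENNReal.toReal_ofReal (by positivity), ENNReal.toReal_inv,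
      ENNReal.toReal_pow, ENNReal.toReal_mul, ENNReal.toReal_add (by simp) (by simp)]
    simp [div_eq_mul_inv]

theorem gammaConst_toReal_lt {r n : ℕ} {θs : Params r} (hγ : gammaConst n θs < 1 / 2) :
    (gammaConst n θs).toReal < 1 / 2 := by
  have h := (ENNReal.toReal_lt_toReal hγ.ne_top (by simp)).2 hγ
  simpa using h

theorem wrap_distance_ge {r n : ℕ} (hr : 1 ≤ r) {θs : Params r} (ha : ∀ j, θs.1 j ≠ 0)
    (hγ : gammaConst n θs < 1 / 2) {j l : Fin r} (hl : l ≠ j) :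
    4.8 ≤ ((n : ℝ) + 1) * |θs.2 j - θs.2 l - round (θs.2 j - θs.2 l)| := by
  obtain ⟨D, hD, hsep, hg⟩ := exists_separation hr ha hγ hl
  have hlt := gammaConst_toReal_lt hγ
  have hκ := one_le_dynamicRange hr ha
  rw [hg, div_lt_iff₀ (by positivity)] at hlt
  -- A dynamic range of at least 1 and γ < 1/2 force ((n+1)D)² > 23.2 > 4.8².
  have h1 : 4.8 ≤ ((n : ℝ) + 1) * D := by
    by_contra hcon
    have : 0 < ((n : ℝ) + 1) * D := by positivity
    nlinarith
  have h2 : D ≤ |θs.2 j - θs.2 l - round (θs.2 j - θs.2 l)| := by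
    simpa [sub_eq_add_neg] using hsep j l hl.symm (-round (θs.2 j - θs.2 l))
  refine h1.trans ?_
  gcongr

/-- The factor 2.25 is (0.5 + 1.3)/0.8: the tail constants of F' and F'', over the share 0.8 of γ
that `location_step_le` allows. With π²/3 ≤ 4 it costs 9 ≤ 11.60. A single spike gives an empty sum.
-/
theorem interaction_sum_le {r n : ℕ} (hr : 1 ≤ r) {θs : Params r} (ha : ∀ j, θs.1 j ≠ 0)
    (hγ : gammaConst n θs < 1 / 2) (j : Fin r) :
    2.25 * (‖θs.1‖ / ampMin θs.1 * ∑ l ∈ univ.erase j,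
      1 / (((n : ℝ) + 1) * |θs.2 j - θs.2 l - round (θs.2 j - θs.2 l)|) ^ 2) ≤
      (gammaConst n θs).toReal := by
  by_cases hex : ∃ l, l ≠ j
  · obtain ⟨l, hl⟩ := hex
    obtain ⟨D, hD, hsep, hg⟩ := exists_separation hr ha hγ hl
    have hκ := one_le_dynamicRange hr ha
    have h := sum_inv_sq_wrap_le θs.2 hD hsep j
    have hpi : Real.pi ^ 2 / 3 ≤ 4 := by nlinarith [Real.pi_lt_d2, Real.pi_pos]
    have h2 : ∑ l ∈ univ.erase j,
        1 / (((n : ℝ) + 1) * |θs.2 j - θs.2 l - round (θs.2 j - θs.2 l)|) ^ 2 ≤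
        4 / (((n : ℝ) + 1) * D) ^ 2 := by
      have e : ∀ y : ℝ, 1 / (((n : ℝ) + 1) * y) ^ 2 = 1 / ((n : ℝ) + 1) ^ 2 * (1 / y ^ 2) := by
        intro y; rw [mul_pow, one_div_mul_one_div]
      simp only [e, ← Finset.mul_sum]
      calc _ ≤ 1 / ((n : ℝ) + 1) ^ 2 * (4 / D ^ 2) := by
            gcongr; exact h.trans (by gcongr)
        _ = _ := by rw [mul_pow, div_mul_div_comm, one_mul]
    rw [hg]
    calc _ ≤ 2.25 * (‖θs.1‖ / ampMin θs.1 * (4 / (((n : ℝ) + 1) * D) ^ 2)) := by gcongr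
      _ = 9 * (‖θs.1‖ / ampMin θs.1) / (((n : ℝ) + 1) * D) ^ 2 := by ring
      _ ≤ _ := by gcongr; norm_num
  · push Not at hex
    have : univ.erase j = ∅ := by
      ext l; simp [hex l]
    rw [this]
    simp

/-! ### Perturbation and single-spike estimates -/

/-- Perturbation of a kernel interaction when amplitude and location move. -/
theorem norm_kernel_perturbation_le {K K' : ℝ → ℝ} (hK : ∀ t, HasDerivAt K (K' t) t)
    {x ρ B C s ε u v : ℝ} {a b : ℂ} (hB : ∀ t, |t - x| ≤ ρ → |K t| ≤ B)
    (hC : ∀ t, |t - x| ≤ ρ → |K' t| ≤ s * C) (hu : |u - x| ≤ ρ) (hv : |v - x| ≤ ρ) (hC0 : 0 ≤ C)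
    (hab : ‖a - b‖ ≤ ε * ‖b‖) (huv : s * |u - v| ≤ ε) :
    ‖a * K u - b * K v‖ ≤ ‖b‖ * ε * (B + C) := by
  have hε : 0 ≤ ε * ‖b‖ := (norm_nonneg _).trans hab
  have hmv : |K u - K v| ≤ s * C * |u - v| := by
    have h := (convex_closedBall x ρ).norm_image_sub_le_of_norm_hasDerivWithin_le (f := K)
      (f' := K') (C := s * C) (fun t _ => (hK t).hasDerivWithinAt)
      (fun t ht => by simpa using hC t (by simpa [Real.dist_eq] using ht))
      (by simpa [Real.dist_eq] using hv) (by simpa [Real.dist_eq] using hu)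
    simpa using h
  have hmv' : |K u - K v| ≤ C * ε := by nlinarith
  have e : a * K u - b * K v = (a - b) * (K u : ℂ) + b * ((K u - K v : ℝ) : ℂ) := by
    push_cast; ring
  rw [e]
  refine (norm_add_le _ _).trans ?_
  rw [norm_mul, norm_mul, Complex.norm_real, Complex.norm_real, Real.norm_eq_abs, Real.norm_eq_abs]
  calc ‖a - b‖ * |K u| + ‖b‖ * |K u - K v| ≤ ε * ‖b‖ * B + ‖b‖ * (C * ε) := by
        gcongr
        exact hB u hu
    _ = _ := by ring

/-- Here f stands for F'(δ) and E for the cross terms. The new error splits into the amplitude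
mismatch sδ(1 - Re(b/a)), the cubic remainder of f, and E/a. The first two use 1.225(0.1836 +
0.1836²) < 1/2; in the third, |b/a| ≤ 1.225 turns 0.8γ into 0.98γ. -/
theorem location_step_le {s δ f ε γ : ℝ} {a b E : ℂ} (hs : 0 < s) (hb : b ≠ 0)
    (hab : ‖a - b‖ ≤ ε * ‖b‖) (hε0 : 0 ≤ ε) (hε : ε ≤ 0.1836) (hδ : s * |δ| ≤ ε) (hγ : 0 ≤ γ)
    (hf : |f + s ^ 2 * δ| ≤ s ^ 4 * |δ| ^ 3) (hE : ‖E‖ ≤ ‖b‖ * ε * s * (0.8 * γ)) :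
    |s * (δ - (s ^ 2)⁻¹ * (‖a‖ ^ 2)⁻¹ * (conj a * (-(b * f) + E)).re)| ≤ (1 / 2 + γ) * ε := by
  have hb0 : 0 < ‖b‖ := norm_pos_iff.2 hb
  have ha1 : 0.8164 * ‖b‖ ≤ ‖a‖ := by
    have h : ‖b‖ ≤ ‖a‖ + ‖a - b‖ := by
      rw [norm_sub_rev]; simpa using norm_add_le a (b - a)
    nlinarith
  have ha0 : 0 < ‖a‖ := lt_of_lt_of_le (by positivity) ha1
  have ha : a ≠ 0 := norm_pos_iff.1 ha0
  have hinv : (((‖a‖ ^ 2)⁻¹ : ℝ) : ℂ) * conj a = a⁻¹ := by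
    rw [Complex.inv_def, Complex.normSq_eq_norm_sq, mul_comm]
  have hre : (‖a‖ ^ 2)⁻¹ * (conj a * (-(b * f) + E)).re = -(f * (b / a).re) + (E / a).re := by
    rw [← Complex.re_ofReal_mul, ← mul_assoc, hinv,
      show a⁻¹ * (-(b * f) + E) = -((f : ℂ) * (b / a)) + E / a by ring, Complex.add_re,
      Complex.neg_re, Complex.re_ofReal_mul]
  have hba : ‖b / a‖ ≤ 1.225 := by
    rw [norm_div, div_le_iff₀ ha0]; linarith
  have hρ : |(b / a).re| ≤ 1.225 := (Complex.abs_re_le_norm _).trans hba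
  have hρ1 : |1 - (b / a).re| ≤ 1.225 * ε := by
    have h1 : 1 - (b / a).re = ((a - b) / a).re := by rw [sub_div, div_self ha]; simp
    rw [h1]
    refine (Complex.abs_re_le_norm _).trans ?_
    rw [norm_div, div_le_iff₀ ha0]
    nlinarith
  have hEa : |(E / a).re| ≤ s * (0.98 * γ * ε) := by
    refine (Complex.abs_re_le_norm _).trans ?_
    rw [norm_div, div_le_iff₀ ha0]
    refine hE.trans ?_
    have h0 : 0 ≤ ε * s * γ := by positivity
    nlinarith [mul_le_mul_of_nonneg_left ha1 h0]
  have hdec : s * (δ - (s ^ 2)⁻¹ * (‖a‖ ^ 2)⁻¹ * (conj a * (-(b * f) + E)).re) =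
      s * δ * (1 - (b / a).re) + s⁻¹ * (f + s ^ 2 * δ) * (b / a).re - s⁻¹ * (E / a).re := by
    rw [mul_assoc (s ^ 2)⁻¹, hre]
    field_simp
    ring
  have hx : 0 ≤ s * |δ| := by positivity
  have t1 : |s * δ * (1 - (b / a).re)| ≤ ε * (1.225 * 0.1836) := by
    rw [abs_mul, abs_mul, abs_of_pos hs]
    gcongr
    linarith
  have t2 : |s⁻¹ * (f + s ^ 2 * δ) * (b / a).re| ≤ ε * 0.1836 ^ 2 * 1.225 := by
    rw [abs_mul, abs_mul, abs_of_pos (inv_pos.2 hs)]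
    refine mul_le_mul ?_ hρ (abs_nonneg _) (by positivity)
    calc s⁻¹ * |f + s ^ 2 * δ| ≤ s⁻¹ * (s ^ 4 * |δ| ^ 3) := by gcongr
      _ = (s * |δ|) * (s * |δ|) ^ 2 := by field_simp
      _ ≤ ε * 0.1836 ^ 2 := by
        gcongr
        exact hδ.trans hε
  have t3 : |s⁻¹ * (E / a).re| ≤ 0.98 * γ * ε := by
    rw [abs_mul, abs_of_pos (inv_pos.2 hs), inv_mul_le_iff₀ hs]
    exact hEa
  rw [hdec]
  refine (abs_sub _ _).trans ((add_le_add ((abs_add_le _ _).trans (add_le_add t1 t2)) t3).trans ?_)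
  nlinarith [mul_nonneg hγ hε0]

theorem amplitude_step_le {F ε γ : ℝ} {b E : ℂ} (hb : b ≠ 0) (hF0 : 0 ≤ 1 - F)
    (hF : 1 - F ≤ ε ^ 2 / 2) (hε0 : 0 ≤ ε) (hε : ε ≤ 0.1836) (hE : ‖E‖ ≤ ‖b‖ * ε * γ) :
    ‖b⁻¹ * (-(b * ((1 - F : ℝ) : ℂ)) - E)‖ ≤ (1 / 2 + γ) * ε := by
  have hb0 : 0 < ‖b‖ := norm_pos_iff.2 hb
  rw [norm_mul, norm_inv, inv_mul_le_iff₀ hb0]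
  refine (norm_sub_le _ _).trans ?_
  rw [norm_neg, norm_mul, Complex.norm_real, Real.norm_eq_abs, abs_of_nonneg hF0]
  have h : 1 - F ≤ 1 / 2 * ε := by nlinarith
  nlinarith [mul_le_mul_of_nonneg_left h hb0.le]

/-! ### Contraction of one step -/

theorem sqrt_neg_fejerCurv_pos {n : ℕ} (hn : 2 ≤ n) : 0 < √(-fejerCurv n) :=
  lt_of_lt_of_le (by positivity) (sqrt_neg_fejerCurv_ge hn)

theorem sq_sqrt_neg_fejerCurv {n : ℕ} (hn : 2 ≤ n) : √(-fejerCurv n) ^ 2 = -fejerCurv n :=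
  Real.sq_sqrt (le_trans (by positivity) (neg_fejerCurv_ge hn))

theorem norm_scale_le_iff {r n : ℕ} {θs v : Params r} {R : ℝ} (hR : 0 ≤ R) :
    ‖scale n θs v‖ ≤ R ↔
      (∀ j, ‖(θs.1 j)⁻¹ * v.1 j‖ ≤ R) ∧ ∀ j, |√(-fejerCurv n) * v.2 j| ≤ R := by
  rw [Prod.norm_def, sup_le_iff, pi_norm_le_iff_of_nonneg hR, pi_norm_le_iff_of_nonneg hR]
  rfl

theorem norm_amplitude_sub_le {r n : ℕ} {θs v : Params r} (ha : ∀ j, θs.1 j ≠ 0) (j : Fin r) :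
    ‖v.1 j‖ ≤ ‖scale n θs v‖ * ‖θs.1 j‖ := by
  have h := ((norm_scale_le_iff (norm_nonneg _)).1 (le_refl ‖scale n θs v‖)).1 j
  have hb : 0 < ‖θs.1 j‖ := norm_pos_iff.2 (ha j)
  rwa [norm_mul, norm_inv, inv_mul_le_iff₀ hb, mul_comm] at h

theorem abs_location_sub_le {r n : ℕ} {θs v : Params r} (j : Fin r) :
    √(-fejerCurv n) * |v.2 j| ≤ ‖scale n θs v‖ := by
  have h := ((norm_scale_le_iff (norm_nonneg _)).1 (le_refl ‖scale n θs v‖)).2 j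
  rwa [abs_mul, abs_of_nonneg (Real.sqrt_nonneg _)] at h

theorem residual_eq_self_add {r : ℕ} (K : ℝ → ℝ) (θs θ : Params r) (j : Fin r) :
    residual K θs θ (θ.2 j) = θ.1 j * K 0 - θs.1 j * K (θ.2 j - θs.2 j) +
      ∑ l ∈ univ.erase j, (θ.1 l * K (θ.2 j - θ.2 l) - θs.1 l * K (θ.2 j - θs.2 l)) := by
  rw [residual, ← Finset.add_sum_erase _ _ (mem_univ j), sub_self]

section Step

variable {r n : ℕ} {θs θ : Params r}

/-- Cross interactions of any kernel obeying the Fejér-type tail bounds. -/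
theorem norm_cross_sum_le (hr : 1 ≤ r) (hn : 2 ≤ n) (ha : ∀ j, θs.1 j ≠ 0)
    (hγ : gammaConst n θs < 1 / 2) (hε : ‖scale n θs (θ - θs)‖ ≤ 0.1836) {K K' : ℝ → ℝ}
    (hK : ∀ t, HasDerivAt K (K' t) t) {B C : ℝ} (hB0 : 0 ≤ B) (hC0 : 0 ≤ C)
    (hB : ∀ x t : ℝ, 4.8 ≤ ((n : ℝ) + 1) * |x - round x| → ((n : ℝ) + 1) * |t - x| ≤ 0.16 →
      |K t| ≤ B / (((n : ℝ) + 1) * |x - round x|) ^ 2)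
    (hC : ∀ x t : ℝ, 4.8 ≤ ((n : ℝ) + 1) * |x - round x| → ((n : ℝ) + 1) * |t - x| ≤ 0.16 →
      |K' t| ≤ √(-fejerCurv n) * C / (((n : ℝ) + 1) * |x - round x|) ^ 2) (j : Fin r) :
    ‖∑ l ∈ univ.erase j, (θ.1 l * K (θ.2 j - θ.2 l) - θs.1 l * K (θ.2 j - θs.2 l))‖ ≤
      ‖θs.1 j‖ * ‖scale n θs (θ - θs)‖ * ((B + C) * ((gammaConst n θs).toReal / 2.25)) := by
  set s := √(-fejerCurv n) with hs
  set ε := ‖scale n θs (θ - θs)‖ with hεdef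
  have hs0 : 0 < s := sqrt_neg_fejerCurv_pos hn
  have hsM := sqrt_neg_fejerCurv_ge hn
  have hM : 0 < (n : ℝ) + 1 := by positivity
  have hε0 : 0 ≤ ε := norm_nonneg _
  have hloc : ∀ l, s * |θ.2 l - θs.2 l| ≤ ε := fun l => abs_location_sub_le (v := θ - θs) l
  -- As s ≥ 2.4(n+1), each location moves by at most 0.1836/(2.4(n+1)) < 0.08/(n+1). A difference of
  -- two locations then stays within the radius 0.16 of the tail bounds.
  have hloc' : ∀ l, |θ.2 l - θs.2 l| ≤ 0.08 / ((n : ℝ) + 1) := fun l => by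
    rw [le_div_iff₀ hM]
    have h1 := hloc l
    have h2 := mul_le_mul_of_nonneg_right hsM (abs_nonneg (θ.2 l - θs.2 l))
    nlinarith
  have hterm : ∀ l ∈ univ.erase j,
      ‖θ.1 l * K (θ.2 j - θ.2 l) - θs.1 l * K (θ.2 j - θs.2 l)‖ ≤
        ‖θs.1‖ / ampMin θs.1 * ‖θs.1 j‖ * ε * ((B + C) *
          (1 / (((n : ℝ) + 1) * |θs.2 j - θs.2 l - round (θs.2 j - θs.2 l)|) ^ 2)) := by
    intro l hl
    have hlj := ne_of_mem_erase hl
    have hd := wrap_distance_ge hr ha hγ hlj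
    set q := ((n : ℝ) + 1) * |θs.2 j - θs.2 l - round (θs.2 j - θs.2 l)| with hq
    have hball : ∀ t, |t - (θs.2 j - θs.2 l)| ≤ 0.16 / ((n : ℝ) + 1) →
        ((n : ℝ) + 1) * |t - (θs.2 j - θs.2 l)| ≤ 0.16 := fun t ht => by
      rwa [le_div_iff₀ hM, mul_comm] at ht
    have h1 : |θ.2 j - θ.2 l - (θs.2 j - θs.2 l)| ≤ 0.16 / ((n : ℝ) + 1) := by
      rw [show θ.2 j - θ.2 l - (θs.2 j - θs.2 l) =
        (θ.2 j - θs.2 j) - (θ.2 l - θs.2 l) by ring]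
      refine (abs_sub _ _).trans ((add_le_add (hloc' j) (hloc' l)).trans (le_of_eq ?_))
      ring
    have h2 : |θ.2 j - θs.2 l - (θs.2 j - θs.2 l)| ≤ 0.16 / ((n : ℝ) + 1) := by
      rw [show θ.2 j - θs.2 l - (θs.2 j - θs.2 l) = θ.2 j - θs.2 j by ring]
      exact (hloc' j).trans (by gcongr; norm_num)
    have h := norm_kernel_perturbation_le hK (x := θs.2 j - θs.2 l) (s := s) (ε := ε)
      (B := B / q ^ 2) (C := C / q ^ 2) (a := θ.1 l) (b := θs.1 l)
      (fun t ht => hB _ t hd (hball t ht))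
      (fun t ht => by rw [← mul_div_assoc]; exact hC _ t hd (hball t ht)) h1 h2 (by positivity)
      (norm_amplitude_sub_le (v := θ - θs) ha l)
      (by
        rw [show θ.2 j - θ.2 l - (θ.2 j - θs.2 l) = -(θ.2 l - θs.2 l) by ring, abs_neg]
        exact hloc l)
    refine h.trans ?_
    rw [← add_div, div_eq_mul_one_div (B + C)]
    gcongr
    exact norm_le_dynamicRange_mul hr ha l j
  refine (norm_sum_le _ _).trans ((Finset.sum_le_sum hterm).trans ?_)
  rw [← Finset.mul_sum, ← Finset.mul_sum]
  have hint := interaction_sum_le hr ha hγ j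
  rw [mul_comm 2.25, ← le_div_iff₀ (by norm_num)] at hint
  calc _ = ‖θs.1 j‖ * ε * ((B + C) * (‖θs.1‖ / ampMin θs.1 * ∑ l ∈ univ.erase j,
        1 / (((n : ℝ) + 1) * |θs.2 j - θs.2 l - round (θs.2 j - θs.2 l)|) ^ 2)) := by ring
    _ ≤ _ := by gcongr

theorem norm_scale_step_le (hr : 1 ≤ r) (hn : 2 ≤ n) (ha : ∀ j, θs.1 j ≠ 0)
    (hγ : gammaConst n θs < 1 / 2) (hε : ‖scale n θs (θ - θs)‖ ≤ 0.1836) :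
    ‖scale n θs (θ - precond n θ (gradLoss n θs θ) - θs)‖ ≤
      (1 / 2 + (gammaConst n θs).toReal) * ‖scale n θs (θ - θs)‖ := by
  have hs0 := sqrt_neg_fejerCurv_pos hn
  have hs2 := sq_sqrt_neg_fejerCurv hn
  have hγ0 : 0 ≤ (gammaConst n θs).toReal := ENNReal.toReal_nonneg
  have hε0 : 0 ≤ ‖scale n θs (θ - θs)‖ := norm_nonneg _
  have hloc : ∀ l, √(-fejerCurv n) * |θ.2 l - θs.2 l| ≤ ‖scale n θs (θ - θs)‖ :=
    fun l => abs_location_sub_le (v := θ - θs) l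
  rw [norm_scale_le_iff (by positivity)]
  refine ⟨fun j => ?_, fun j => ?_⟩
  · have hE := norm_cross_sum_le hr hn ha hγ hε (hasDerivAt_fejer n) (B := 0.3) (C := 0.5)
      (by norm_num) (by norm_num) (fun x t h1 h2 => abs_fejer_tail_le h1 h2)
      (fun x t h1 h2 => by rw [mul_comm _ (0.5 : ℝ)]; exact abs_fejerDeriv_tail_le hn h1 h2) j
    have h0 : fejer n 0 = 1 := by simp [fejer_eq_sum, sum_fejerCoeff]
    have hstep : (θ - precond n θ (gradLoss n θs θ) - θs).1 j =
        -(θs.1 j * ((1 - fejer n (θ.2 j - θs.2 j) : ℝ) : ℂ)) - ∑ l ∈ univ.erase j,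
          (θ.1 l * fejer n (θ.2 j - θ.2 l) - θs.1 l * fejer n (θ.2 j - θs.2 l)) := by
      change θ.1 j - (gradLoss n θs θ).1 j - θs.1 j = _
      rw [gradLoss_amplitude, residual_eq_self_add, h0]
      push_cast; ring
    rw [hstep]
    refine amplitude_step_le (ha j) (one_sub_fejer_nonneg _ _) ?_ hε0 hε (hE.trans ?_)
    · refine (one_sub_fejer_le _ _).trans ?_
      rw [← hs2, ← mul_pow, ← sq_abs, abs_mul, abs_of_pos hs0]
      gcongr
      exact hloc j
    · gcongr
      -- The tail constants satisfy 0.3 + 0.5 ≤ 2.25.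
      rw [← mul_div_assoc, div_le_iff₀ (by norm_num)]
      linarith
  · have hE := norm_cross_sum_le hr hn ha hγ hε (hasDerivAt_fejerDeriv n)
      (B := √(-fejerCurv n) * 0.5) (C := √(-fejerCurv n) * 1.3)
      (by positivity) (by positivity)
      (fun x t h1 h2 => by rw [mul_comm _ (0.5 : ℝ)]; exact abs_fejerDeriv_tail_le hn h1 h2)
      (fun x t h1 h2 => by
        rw [show √(-fejerCurv n) * (√(-fejerCurv n) * 1.3) = 1.3 * √(-fejerCurv n) ^ 2 by ring]
        exact abs_fejerDeriv2_tail_le hn h1 h2) j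
    have h0 : fejerDeriv n 0 = 0 := by simp [fejerDeriv]
    have hstep : (θ - precond n θ (gradLoss n θs θ) - θs).2 j =
        θ.2 j - θs.2 j - (√(-fejerCurv n) ^ 2)⁻¹ * (‖θ.1 j‖ ^ 2)⁻¹ *
          (conj (θ.1 j) * (-(θs.1 j * (fejerDeriv n (θ.2 j - θs.2 j) : ℂ)) +
            ∑ l ∈ univ.erase j, (θ.1 l * fejerDeriv n (θ.2 j - θ.2 l) -
              θs.1 l * fejerDeriv n (θ.2 j - θs.2 l)))).re := by
      change θ.2 j - -(fejerCurv n)⁻¹ * (‖θ.1 j‖ ^ 2)⁻¹ * (gradLoss n θs θ).2 j - θs.2 j = _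
      rw [gradLoss_location, residual_eq_self_add, h0, hs2, inv_neg, Complex.ofReal_zero, mul_zero,
        zero_sub]
      ring
    rw [hstep]
    -- The last goal is the identity (0.5 + 1.3)/2.25 = 0.8.
    refine location_step_le hs0 (ha j) (norm_amplitude_sub_le (v := θ - θs) ha j) hε0 hε (hloc j)
      hγ0 ?_ (hE.trans (le_of_eq ?_))
    · have h := abs_fejerDeriv_sub_linear_le n (θ.2 j - θs.2 j)
      rw [← neg_sq, ← hs2] at h
      rw [hs2]
      calc _ = |fejerDeriv n (θ.2 j - θs.2 j) - fejerCurv n * (θ.2 j - θs.2 j)| := by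
            congr 1; ring
        _ ≤ _ := h.trans (le_of_eq (by ring))
    · ring

end Step

/-! ### Convergence of the iterates -/

theorem tendsto_of_norm_scale_tendsto_zero {r n : ℕ} (hn : 2 ≤ n) {θs : Params r}
    (ha : ∀ j, θs.1 j ≠ 0) {θ : ℕ → Params r}
    (h : Filter.Tendsto (fun k => ‖scale n θs (θ k - θs)‖) Filter.atTop (nhds 0)) :
    Filter.Tendsto θ Filter.atTop (nhds θs) := by
  have hs0 := sqrt_neg_fejerCurv_pos hn
  rw [Prod.tendsto_iff, tendsto_pi_nhds, tendsto_pi_nhds]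
  refine ⟨fun j => ?_, fun j => ?_⟩
  · rw [tendsto_iff_norm_sub_tendsto_zero]
    refine squeeze_zero (fun _ => norm_nonneg _)
      (fun k => norm_amplitude_sub_le (n := n) (v := θ k - θs) ha j) ?_
    simpa using h.mul_const ‖θs.1 j‖
  · rw [tendsto_iff_norm_sub_tendsto_zero]
    refine squeeze_zero (fun _ => norm_nonneg _) (fun k => ?_)
      (by simpa using h.div_const √(-fejerCurv n))
    rw [le_div_iff₀ hs0, mul_comm]
    exact abs_location_sub_le (v := θ k - θs) j

end SpikeDeconv

theorem theorem2 (r n : ℕ) (hr : 1 ≤ r) (hn : 2 ≤ n)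
    (θs : SpikeDeconv.Params r) (ha : ∀ j, θs.1 j ≠ 0)
    (hγ : SpikeDeconv.gammaConst n θs < 1 / 2)
    (θ : ℕ → SpikeDeconv.Params r)
    (hθ : ∀ k, θ (k + 1) =
      θ k - SpikeDeconv.precond n (θ k) (SpikeDeconv.gradLoss n θs (θ k)))
    (h0 : ‖SpikeDeconv.scale n θs (θ 0 - θs)‖ ≤ 1 - √(2 / 3)) :
    (∀ k : ℕ, ‖SpikeDeconv.scale n θs (θ k - θs)‖ ≤
      (1 / 2 + (SpikeDeconv.gammaConst n θs).toReal) ^ k *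
        ‖SpikeDeconv.scale n θs (θ 0 - θs)‖) ∧
    Filter.Tendsto θ Filter.atTop (nhds θs) := by
  have hγ0 : 0 ≤ (SpikeDeconv.gammaConst n θs).toReal := ENNReal.toReal_nonneg
  have hγ1 := SpikeDeconv.gammaConst_toReal_lt hγ
  have hε0 : ‖SpikeDeconv.scale n θs (θ 0 - θs)‖ ≤ 0.1836 := by
    have h : 0.8164 ≤ √(2 / 3) := Real.le_sqrt_of_sq_le (by norm_num)
    linarith
  have hrate : ∀ k : ℕ, ‖SpikeDeconv.scale n θs (θ k - θs)‖ ≤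
      (1 / 2 + (SpikeDeconv.gammaConst n θs).toReal) ^ k *
        ‖SpikeDeconv.scale n θs (θ 0 - θs)‖ := by
    intro k
    induction k with
    | zero => simp
    | succ k ih =>
      -- The rate is below 1, so the iterate has not left the region where one step contracts.
      have hle : ‖SpikeDeconv.scale n θs (θ k - θs)‖ ≤ 0.1836 :=
        (ih.trans (mul_le_of_le_one_left (norm_nonneg _)
          (pow_le_one₀ (by positivity) (by linarith)))).trans hε0
      rw [hθ k]
      refine (SpikeDeconv.norm_scale_step_le hr hn ha hγ hle).trans ?_
      rw [pow_succ', mul_assoc]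
      gcongr
  refine ⟨hrate, SpikeDeconv.tendsto_of_norm_scale_tendsto_zero hn ha ?_⟩
  refine squeeze_zero (fun _ => norm_nonneg _) hrate ?_
  simpa using (tendsto_pow_atTop_nhds_zero_of_lt_one (by positivity)
    (by linarith : 1 / 2 + (SpikeDeconv.gammaConst n θs).toReal < 1)).mul_const _
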